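/- **Lemma 1.** Consider over-the-air federated learning with $N\ge 1$ clients and parameter dimension $d\ge 2$. Client $n$ has a differentiable local loss $f_n:\mathbb R^d\to\mathbb R$ with $\|\nabla f_n(w)\|\le G$ for all $w$. Starting from a fixed $w_0$, in round $k=0,1,2,\dots$ the server receives $$g_k=\frac1N\sum_{n=1}^N h_{n,k}\nabla f_n(w_k)+\xi_k$$ and updates $w_{k+1}=w_k-\eta\,\mathrm{MAC}(g_k,C)$. Here the fading coefficients $h_{n,k}$ have unit mean and finite variance, are independent across clients, and are i.i.d. over time. The noise $\xi_k$ has independent entries, each with the symmetric $\alpha$-stable law with tail index $0<\alpha<2$ and scale $\tau>0$, i.e. with characteristic function $t\mapsto e^{-\tau^\alpha|t|^\alpha}$. Median anchored clipping with threshold $C$ acts on $g\in\mathbb R^d$ by $$\mathrm{MAC}(g,C)_i=\mathrm{sgn}(g_i-m)\min\{|g_i-m|,C\}+m,\qquad m=\mathrm{med}(g),$$ where $\mathrm{med}(g)$ is the median of the entries of $g$; for even $d$ it is $(1-\theta)$ times the lower plus $\theta$ times the upper middle entry, for any fixed $\theta\in[0,1]$ (lower, averaged and upper median included). Let $p_C=p_C(k,i)=\mathbb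 P\{|g_{k,i}-\mathrm{med}(g_k)|\le C\}$ be the probability that the $i$-th entry of $g_k$ remains unclipped at threshold $C$. Then, as $C\to\infty$, $$p_C\sim 1-\frac{\tau^\alpha}{C^\alpha},$$ in the following two senses. 1. For every round $k$ and every entry $i$, the ratio of the two sides tends to $1$. 2. The clipping probability is of exact order $\tau^\alpha/C^\alpha$. That is, there are constants $0<a\le b$ depending only on $\alpha$ such that, for all sufficiently large $C$ and simultaneously for all rounds $k$ and all entries $i$, $$a\,\frac{\tau^\alpha}{C^\alpha}\;\le\;1-p_C\;\le\;b\,\frac{\tau^\alpha}{C^\alpha}.$$ -/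

import Mathlib

open MeasureTheory ProbabilityTheory Filter Asymptotics

noncomputable section

/-- The symmetric `α`-stable law on `ℝ` with tail index `α` and scale `τ`: its characteristic
function is `t ↦ exp (-|τ t| ^ α)`. -/
def IsSymmStable (α τ : ℝ) (μ : Measure ℝ) : Prop :=
  ∀ t : ℝ, charFun μ t = Complex.exp (-((|τ * t| ^ α : ℝ) : ℂ))

/-- The `j`-th smallest entry of `v`, counted from `0`. -/
def orderStat {d : ℕ} (v : EuclideanSpace ℝ (Fin d)) (j : Fin d) : ℝ :=
  v (Tuple.sort (fun i => v i) j)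

/-- The median of the entries of `v`. For odd `d` it is the middle entry, whatever `θ` is.
For even `d` it is `(1 - θ) * lower middle entry + θ * upper middle entry`, so that
`θ = 0`, `θ = 1 / 2`, `θ = 1` are the lower, the averaged and the upper median. -/
def vecMedian (θ : ℝ) {d : ℕ} (v : EuclideanSpace ℝ (Fin d)) : ℝ :=
  if hd : 0 < d then
    (1 - θ) * orderStat v ⟨(d - 1) / 2, by omega⟩ + θ * orderStat v ⟨d / 2, by omega⟩
  else 0

/-- Clipping of a number at the threshold `C`: `sgn x * min |x| C`. -/
def clip (C x : ℝ) : ℝ := Real.sign x * min |x| C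

/-- Median anchored clipping: centralize at the median, clip each entry, add the median back. -/
def mac (θ C : ℝ) {d : ℕ} (g : EuclideanSpace ℝ (Fin d)) : EuclideanSpace ℝ (Fin d) :=
  WithLp.toLp 2 fun i => clip C (g i - vecMedian θ g) + vecMedian θ g

/-- The `i`-th entry of `g` is left unclipped by median anchored clipping at threshold `C`. -/
def Unclipped (θ C : ℝ) {d : ℕ} (g : EuclideanSpace ℝ (Fin d)) (i : Fin d) : Prop :=
  |g i - vecMedian θ g| ≤ C

/-- The noisy aggregated gradient `(1 / N) ∑ₙ hₙ ∇fₙ(w) + ξ` received over the air. -/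
def airGradient {d N : ℕ} (f : Fin N → EuclideanSpace ℝ (Fin d) → ℝ) (h : Fin N → ℝ)
    (ξ w : EuclideanSpace ℝ (Fin d)) : EuclideanSpace ℝ (Fin d) :=
  (1 / (N : ℝ)) • ∑ n, h n • gradient (f n) w + ξ

/-- The global parameter `w_k` of over-the-air training with median anchored clipping at
threshold `C`, learning rate `η`, fading `h k n` and noise `ξ k` in round `k`. -/
def macIterate {d N : ℕ} (θ C η : ℝ) (f : Fin N → EuclideanSpace ℝ (Fin d) → ℝ)
    (h : ℕ → Fin N → ℝ) (ξ : ℕ → EuclideanSpace ℝ (Fin d)) (w₀ : EuclideanSpace ℝ (Fin d)) :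
    ℕ → EuclideanSpace ℝ (Fin d)
  | 0 => w₀
  | k + 1 =>
    macIterate θ C η f h ξ w₀ k -
      η • mac θ C (airGradient f (h k) (ξ k) (macIterate θ C η f h ξ w₀ k))

/-- The gradient `g_k` received by the server in round `k`, before clipping. -/
def macGradient {d N : ℕ} (θ C η : ℝ) (f : Fin N → EuclideanSpace ℝ (Fin d) → ℝ)
    (h : ℕ → Fin N → ℝ) (ξ : ℕ → EuclideanSpace ℝ (Fin d)) (w₀ : EuclideanSpace ℝ (Fin d))
    (k : ℕ) : EuclideanSpace ℝ (Fin d) :=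
  airGradient f (h k) (ξ k) (macIterate θ C η f h ξ w₀ k)

/-- The probability that the `i`-th entry of the gradient received in round `k` is left unclipped
when training runs with the threshold `C`. -/
def unclippedProb {Ω : Type*} [MeasurableSpace Ω] (P : Measure Ω) {d N : ℕ} (θ η : ℝ)
    (f : Fin N → EuclideanSpace ℝ (Fin d) → ℝ) (h : ℕ → Fin N → Ω → ℝ)
    (ξ : ℕ → Ω → EuclideanSpace ℝ (Fin d)) (w₀ : EuclideanSpace ℝ (Fin d))
    (k : ℕ) (i : Fin d) (C : ℝ) : ℝ :=
  P.real {ω | Unclipped θ C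
    (macGradient θ C η f (fun l n => h l n ω) (fun l => ξ l ω) w₀ k) i}

end

/-!
The noise has the tail `P (|ξᵢ| > x) ≍ (τ / x) ^ α`, with constants depending only on `α`. The upper
bound is the standard estimate of a tail by the characteristic function near `0`. For the lower
bound (`exists_le_measureReal_abs_gt`), compare `∫ (1 - cos (ε t x))`, which is of order
`(ε τ t) ^ α`, with `ε ^ 2 ∫ (1 - cos (t x))`, which is of order `ε ^ 2 (τ t) ^ α` and dominates the
contribution of `|t x| ≤ π`: as `α < 2`, for small `ε` the difference has to come from the tail.

The received gradient differs from the noise by at most `G` times the largest fading coefficient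
in absolute value, whatever the current parameter is; so no independence of the noise from the
past or from the fading is needed, and by Chebyshev's inequality this difference exceeds a
multiple of `C` with probability `O(C ^ (-2)) = o(C ^ (-α))`, uniformly over the rounds. Two noise
entries exceed a multiple of `C` with probability `O(C ^ (-2α))`. Up to these negligible events at
most one entry is large.
* A single large entry among at least three leaves the median small, so that entry `i` is clipped
  only if `ξᵢ` itself is large; in dimension two a union bound costs only a factor two
  (`one_sub_measureReal_unclipped_le`).
* Conversely, a large `ξᵢ` is clipped at least when its sign is the one for which the median moves
  by at most half of the jump; this sign has probability one half by symmetry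
  (`le_one_sub_measureReal_unclipped`).

So the clipping probability has the exact order `τ ^ α / C ^ α`, with constants free of the
dimension. In particular `p_C` and `1 - τ ^ α / C ^ α` both tend to `1`, which gives the
asymptotic equivalence.
-/

/-! ### Tails of symmetric stable laws -/

namespace IsSymmStable

variable {α τ : ℝ} {μ : Measure ℝ}

lemma map_neg_eq [IsProbabilityMeasure μ] (h : IsSymmStable α τ μ) :
    μ.map (fun x => -x) = μ := by
  have : IsProbabilityMeasure (μ.map fun x : ℝ => -x) :=
    Measure.isProbabilityMeasure_map measurable_neg.aemeasurable
  apply Measure.ext_of_charFun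
  ext t
  have h1 := charFun_map_mul (μ := μ) (-1) t
  simp only [neg_mul, one_mul] at h1
  rw [h1, h, h, mul_neg, abs_neg]

lemma measureReal_Iio_neg [IsProbabilityMeasure μ] (h : IsSymmStable α τ μ) (x : ℝ) :
    μ.real (Set.Iio (-x)) = μ.real (Set.Ioi x) := by
  conv_rhs => rw [← h.map_neg_eq]
  rw [map_measureReal_apply measurable_neg measurableSet_Ioi]
  congr 1
  ext y
  simp

lemma two_mul_measureReal_Ioi [IsProbabilityMeasure μ] (h : IsSymmStable α τ μ) {x : ℝ}
    (hx : 0 < x) : 2 * μ.real (Set.Ioi x) = μ.real {y | x < |y|} := by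
  have hU : {y : ℝ | x < |y|} = Set.Ioi x ∪ Set.Iio (-x) := by
    ext y
    simp [lt_abs, lt_neg]
  have hd : Disjoint (Set.Ioi x) (Set.Iio (-x)) := by
    rw [Set.disjoint_left]
    intro y h1 h2
    simp only [Set.mem_Ioi, Set.mem_Iio] at h1 h2
    linarith
  rw [hU, measureReal_union hd measurableSet_Iio, h.measureReal_Iio_neg]
  ring

lemma integral_one_sub_cos [IsProbabilityMeasure μ] (h : IsSymmStable α τ μ) (t : ℝ) :
    ∫ x, (1 - Real.cos (t * x)) ∂μ = 1 - Real.exp (-(|τ * t| ^ α)) := by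
  have hcos : Integrable (fun x : ℝ => Real.cos (t * x)) μ :=
    Integrable.of_bound (by fun_prop) 1 (ae_of_all _ fun x => Real.abs_cos_le_one _)
  rw [integral_sub (integrable_const _) hcos]
  have hint : Integrable (fun x : ℝ => Complex.exp (t * x * Complex.I)) μ :=
    Integrable.of_bound (by fun_prop) 1 (ae_of_all _ fun x => by
      rw [← Complex.ofReal_mul, Complex.norm_exp_ofReal_mul_I])
  have h1 := congrArg Complex.re (h t)
  rw [charFun_apply_real, ← Complex.ofReal_neg, Complex.exp_ofReal_re] at h1
  have h2 := integral_re hint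
  simp only [RCLike.re_eq_complex_re] at h2
  rw [h1] at h2
  have h3 : ∀ x : ℝ, (Complex.exp (t * x * Complex.I)).re = Real.cos (t * x) := fun x => by
    rw [← Complex.ofReal_mul, Complex.exp_ofReal_mul_I_re]
  simp only [h3] at h2
  simp [h2]

/-- The upper tail bound, from the behaviour of the characteristic function near `0`. -/
lemma measureReal_abs_gt_le [IsProbabilityMeasure μ] (h : IsSymmStable α τ μ) (hα : 0 < α)
    (hτ : 0 < τ) {x : ℝ} (hx : 0 < x) :
    μ.real {y | x < |y|} ≤ 2 * 2 ^ α * (τ / x) ^ α := by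
  refine (measureReal_abs_gt_le_integral_charFun hx).trans ?_
  have hb : ‖∫ t in (-2 * x⁻¹)..(2 * x⁻¹), 1 - charFun μ t‖ ≤
      (2 * (τ / x)) ^ α * |2 * x⁻¹ - -2 * x⁻¹| := by
    apply intervalIntegral.norm_integral_le_of_norm_le_const
    intro t ht
    have hx' : 0 < x⁻¹ := inv_pos.2 hx
    rw [Set.uIoc_of_le (by linarith)] at ht
    have ht' : |t| ≤ 2 * x⁻¹ := abs_le.2 ⟨by linarith [ht.1], ht.2⟩
    have h0 : 0 ≤ |τ * t| ^ α := by positivity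
    have hle : |τ * t| ≤ 2 * (τ / x) := by
      rw [abs_mul, abs_of_pos hτ, div_eq_mul_inv]
      nlinarith
    have h1 : 1 - charFun μ t = ((1 - Real.exp (-(|τ * t| ^ α)) : ℝ) : ℂ) := by
      rw [h t]
      push_cast
      rfl
    rw [h1, Complex.norm_real, Real.norm_eq_abs,
      abs_of_nonneg (sub_nonneg.2 (Real.exp_le_one_iff.2 (by linarith)))]
    have h2 := Real.add_one_le_exp (-(|τ * t| ^ α))
    have h3 : |τ * t| ^ α ≤ (2 * (τ / x)) ^ α :=
      Real.rpow_le_rpow (abs_nonneg _) hle hα.le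
    linarith
  have hx' : 0 < x⁻¹ := inv_pos.2 hx
  rw [show 2 * x⁻¹ - -2 * x⁻¹ = 4 * x⁻¹ by ring, abs_of_pos (by positivity),
    Real.mul_rpow (by norm_num) (by positivity)] at hb
  calc 2⁻¹ * x * ‖∫ t in (-2 * x⁻¹)..(2 * x⁻¹), 1 - charFun μ t‖
      ≤ 2⁻¹ * x * (2 ^ α * (τ / x) ^ α * (4 * x⁻¹)) := by gcongr
    _ = 2 * 2 ^ α * (τ / x) ^ α := by field_simp; ring

end IsSymmStable

/-- Damping the frequency by `ε` gains a factor of order `ε ^ 2` on the region `|y| ≤ π`. -/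
lemma one_sub_cos_mul_le (ε y : ℝ) :
    1 - Real.cos (ε * y) ≤ 2 * Set.indicator {z : ℝ | Real.pi < |z|} 1 y +
      ε ^ 2 * (Real.pi ^ 2 / 4) * (1 - Real.cos y) := by
  have hc : 0 ≤ 1 - Real.cos y := sub_nonneg.2 (Real.cos_le_one y)
  by_cases hy : Real.pi < |y|
  · rw [Set.indicator_of_mem (by exact hy), Pi.one_apply]
    have h1 := Real.neg_one_le_cos (ε * y)
    have h2 : 0 ≤ ε ^ 2 * (Real.pi ^ 2 / 4) * (1 - Real.cos y) := by positivity
    linarith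
  · rw [Set.indicator_of_notMem (by exact hy)]
    have h1 := Real.cos_le_one_sub_mul_cos_sq (not_lt.1 hy)
    have h2 := Real.one_sub_sq_div_two_le_cos (x := ε * y)
    have hpi := Real.pi_pos
    have h3 : Real.pi ^ 2 / 4 * (2 / Real.pi ^ 2 * y ^ 2) = y ^ 2 / 2 := by
      field_simp; ring
    have h4 : Real.pi ^ 2 / 4 * (2 / Real.pi ^ 2 * y ^ 2) ≤
        Real.pi ^ 2 / 4 * (1 - Real.cos y) := by gcongr; linarith
    rw [h3] at h4
    nlinarith [mul_le_mul_of_nonneg_left h4 (sq_nonneg ε)]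

/-- The lower tail bound. Only `α < 2` makes the tail heavy: it lets a small damping factor `ε`
satisfy `ε ^ 2 ≪ ε ^ α`, so that the truncated second moment cannot account for all of
`∫ (1 - cos (ε t x))`, and the rest has to come from the tail. -/
lemma exists_le_measureReal_abs_gt {α : ℝ} (hα₀ : 0 < α) (hα₂ : α < 2) :
    ∃ κ : ℝ, 0 < κ ∧ ∀ (τ : ℝ) (μ : Measure ℝ) [IsProbabilityMeasure μ], 0 < τ →
      IsSymmStable α τ μ → ∀ x : ℝ, Real.pi * τ ≤ x →
        κ * (τ / x) ^ α ≤ μ.real {y | x < |y|} := by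
  have hpi := Real.pi_pos
  -- `ε` solves `ε ^ (2 - α) = π ^ (-2)`.
  set ε : ℝ := Real.pi ^ (-(2 / (2 - α))) with hε
  have hε0 : 0 < ε := Real.rpow_pos_of_pos hpi _
  have hε1 : ε ≤ 1 := Real.rpow_le_one_of_one_le_of_nonpos (by linarith [Real.pi_gt_three])
    (neg_nonpos.2 (div_nonneg zero_le_two (by linarith)))
  have hεα : ε ^ 2 * Real.pi ^ 2 = ε ^ α := by
    rw [← Real.rpow_natCast ε 2, ← Real.rpow_natCast Real.pi 2, hε, ← Real.rpow_mul hpi.le,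
      ← Real.rpow_mul hpi.le, ← Real.rpow_add hpi]
    congr 1
    have : 2 - α ≠ 0 := by linarith
    push_cast
    field_simp
    ring
  refine ⟨ε ^ α / 8, by positivity, fun τ μ _ hτ hμ x hx => ?_⟩
  have hx0 : 0 < x := lt_of_lt_of_le (by positivity) hx
  set t : ℝ := Real.pi / x with ht
  have ht0 : 0 < t := by positivity
  have hS : MeasurableSet {y : ℝ | x < |y|} := measurableSet_lt measurable_const (by fun_prop)
  have hind : ∀ y : ℝ, Set.indicator {z : ℝ | Real.pi < |z|} (1 : ℝ → ℝ) (t * y) =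
      Set.indicator {y : ℝ | x < |y|} 1 y := by
    intro y
    have : Real.pi < |t * y| ↔ x < |y| := by
      rw [abs_mul, abs_of_pos ht0, ht, div_mul_eq_mul_div, lt_div_iff₀ hx0]
      exact mul_lt_mul_iff_right₀ hpi
    simp only [Set.indicator_apply, Set.mem_ofPred_eq, this, Pi.one_apply]
  have hcos : ∀ s : ℝ, Integrable (fun y : ℝ => 1 - Real.cos (s * y)) μ := fun s =>
    (integrable_const _).sub
      (Integrable.of_bound (by fun_prop) 1 (ae_of_all _ fun x => Real.abs_cos_le_one _))
  have hI : Integrable (Set.indicator {y : ℝ | x < |y|} (1 : ℝ → ℝ)) μ :=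
    (integrable_const (1 : ℝ)).indicator hS
  have hmono : ∫ y, (1 - Real.cos (ε * t * y)) ∂μ ≤
      ∫ y, (2 * Set.indicator {y : ℝ | x < |y|} 1 y +
        ε ^ 2 * (Real.pi ^ 2 / 4) * (1 - Real.cos (t * y))) ∂μ := by
    refine integral_mono (hcos _) ((hI.const_mul 2).add ((hcos t).const_mul _)) fun y => ?_
    have := one_sub_cos_mul_le ε (t * y)
    rwa [hind, ← mul_assoc] at this
  rw [integral_add (hI.const_mul 2) ((hcos t).const_mul _), integral_const_mul,
    integral_const_mul, integral_indicator_one hS, hμ.integral_one_sub_cos,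
    hμ.integral_one_sub_cos] at hmono
  set y : ℝ := |τ * t| ^ α with hy
  have hτt : |τ * t| = Real.pi * (τ / x) := by
    rw [abs_of_pos (by positivity), ht]; ring
  have hy0 : 0 ≤ y := by positivity
  have hy1 : y ≤ 1 := by
    refine Real.rpow_le_one (abs_nonneg _) ?_ hα₀.le
    rw [hτt, ← mul_div_assoc]
    exact (div_le_one hx0).2 hx
  have hyε : |τ * (ε * t)| ^ α = ε ^ α * y := by
    rw [mul_left_comm, abs_mul, abs_of_pos hε0, Real.mul_rpow hε0.le (abs_nonneg _)]
  have hεα1 : ε ^ α ≤ 1 := Real.rpow_le_one hε0.le hε1 hα₀.le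
  have hεα0 : 0 < ε ^ α := by positivity
  have hz : ε ^ α * y / 2 ≤ 1 - Real.exp (-(ε ^ α * y)) := by
    have hz0 : 0 ≤ ε ^ α * y := by positivity
    have hz1 : ε ^ α * y ≤ 1 := mul_le_one₀ hεα1 hy0 hy1
    have h1 : Real.exp (-(ε ^ α * y)) ≤ (1 + ε ^ α * y)⁻¹ := by
      rw [Real.exp_neg]
      exact inv_anti₀ (by positivity) (by linarith [Real.add_one_le_exp (ε ^ α * y)])
    have h2 : (1 + ε ^ α * y)⁻¹ ≤ 1 - ε ^ α * y / 2 := by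
      rw [inv_le_iff_one_le_mul₀ (by positivity)]
      nlinarith
    linarith
  have hu : 1 - Real.exp (-y) ≤ y := by linarith [Real.add_one_le_exp (-y)]
  rw [hyε] at hmono
  have h5 : ε ^ 2 * (Real.pi ^ 2 / 4) * (1 - Real.exp (-y)) ≤ ε ^ α / 4 * y := by
    rw [← mul_div_assoc, hεα]
    gcongr
  have h6 : (τ / x) ^ α ≤ y := by
    rw [hy, hτt]
    refine Real.rpow_le_rpow (by positivity) ?_ hα₀.le
    have : 0 < τ / x := by positivity
    nlinarith [Real.pi_gt_three]
  have h7 := mul_le_mul_of_nonneg_left h6 hεα0.le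
  linarith

/-! ### Order statistics and the median -/

/-- If all entries but one are at most `B`, only the largest entry can exceed `B`. -/
lemma orderStat_le {d : ℕ} {v : EuclideanSpace ℝ (Fin d)} {B : ℝ} {i m : Fin d}
    (hm : (m : ℕ) + 1 < d) (hv : ∀ j, j ≠ i → v j ≤ B) : orderStat v m ≤ B := by
  have hmono := Tuple.monotone_sort (fun j => v j)
  have hle : m ≤ ⟨m + 1, hm⟩ := Nat.le_succ _
  by_cases h : Tuple.sort (fun j => v j) m = i
  · refine le_trans (hmono hle) (hv _ fun h' => ?_)
    have := (Tuple.sort fun j => v j).injective (h.trans h'.symm)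
    simpa using congrArg Fin.val this
  · exact hv _ h

/-- If all entries but one are at least `B`, only the smallest entry can be less than `B`. -/
lemma le_orderStat {d : ℕ} {v : EuclideanSpace ℝ (Fin d)} {B : ℝ} {i m : Fin d}
    (hm : 0 < (m : ℕ)) (hv : ∀ j, j ≠ i → B ≤ v j) : B ≤ orderStat v m := by
  have hmono := Tuple.monotone_sort (fun j => v j)
  have hle : (⟨m - 1, by omega⟩ : Fin d) ≤ m := Nat.pred_le _
  by_cases h : Tuple.sort (fun j => v j) m = i
  · refine le_trans (hv _ fun h' => ?_) (hmono hle)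
    have := congrArg Fin.val ((Tuple.sort fun j => v j).injective (h.trans h'.symm))
    simp only at this
    omega
  · exact hv _ h

section Median

variable {d : ℕ} {θ : ℝ} {v : EuclideanSpace ℝ (Fin d)}

lemma abs_vecMedian_le (hd : 0 < d) (hθ : θ ∈ Set.Icc (0 : ℝ) 1) {B : ℝ}
    (h₁ : |orderStat v ⟨(d - 1) / 2, by omega⟩| ≤ B) (h₂ : |orderStat v ⟨d / 2, by omega⟩| ≤ B) :
    |vecMedian θ v| ≤ B := by
  obtain ⟨hθ0, hθ1⟩ := hθ
  rw [vecMedian, dif_pos hd]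
  rw [abs_le] at *
  constructor <;> nlinarith

lemma abs_vecMedian_le_of_forall (hd : 0 < d) (hθ : θ ∈ Set.Icc (0 : ℝ) 1) {B : ℝ}
    (hv : ∀ j, |v j| ≤ B) : |vecMedian θ v| ≤ B :=
  abs_vecMedian_le hd hθ (hv _) (hv _)

/-- A single outlier among at least three entries does not move the median. -/
lemma abs_vecMedian_le_of_forall_ne (hd : 3 ≤ d) (hθ : θ ∈ Set.Icc (0 : ℝ) 1) {B : ℝ} {i : Fin d}
    (hv : ∀ j, j ≠ i → |v j| ≤ B) : |vecMedian θ v| ≤ B := by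
  refine abs_vecMedian_le (by omega) hθ ?_ ?_ <;> rw [abs_le]
  · exact ⟨le_orderStat (by simp only; omega) fun j hj => (abs_le.1 (hv j hj)).1,
      orderStat_le (by simp only; omega) fun j hj => (abs_le.1 (hv j hj)).2⟩
  · exact ⟨le_orderStat (by simp only; omega) fun j hj => (abs_le.1 (hv j hj)).1,
      orderStat_le (by simp only; omega) fun j hj => (abs_le.1 (hv j hj)).2⟩

/-- For `d = 2` the outlier does move the median, but by at most the fraction `θ` of the gap, so
that an upward outlier is clipped when `θ ≤ 1 / 2`. -/
lemma lt_sub_vecMedian (hd : 2 ≤ d) (hθ : θ ≤ 1 / 2) (hθ0 : 0 ≤ θ) {C : ℝ} (hC : 0 < C)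
    {i : Fin d} (hi : 3 * C < v i) (hv : ∀ j, j ≠ i → v j ≤ C / 2) :
    C < v i - vecMedian θ v := by
  have h₁ : orderStat v ⟨(d - 1) / 2, by omega⟩ ≤ C / 2 :=
    orderStat_le (i := i) (by simp only; omega) hv
  have h₂ : orderStat v ⟨d / 2, by omega⟩ ≤ v i := by
    have hall : ∀ j, v j ≤ v i := fun j => by
      by_cases h : j = i
      · rw [h]
      · linarith [hv j h]
    exact hall _
  rw [vecMedian, dif_pos (by omega)]
  nlinarith

lemma sub_vecMedian_lt_neg (hd : 2 ≤ d) (hθ : 1 / 2 ≤ θ) (hθ1 : θ ≤ 1) {C : ℝ} (hC : 0 < C)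
    {i : Fin d} (hi : v i < -(3 * C)) (hv : ∀ j, j ≠ i → -(C / 2) ≤ v j) :
    v i - vecMedian θ v < -C := by
  have h₁ : v i ≤ orderStat v ⟨(d - 1) / 2, by omega⟩ := by
    have hall : ∀ j, v i ≤ v j := fun j => by
      by_cases h : j = i
      · rw [h]
      · linarith [hv j h]
    exact hall _
  have h₂ : -(C / 2) ≤ orderStat v ⟨d / 2, by omega⟩ :=
    le_orderStat (i := i) (by simp only; omega) hv
  rw [vecMedian, dif_pos (by omega)]
  nlinarith

end Median

/-! ### The aggregated gradient without noise -/

lemma abs_airGradient_sub_le {d N : ℕ} (hN : 1 ≤ N) {f : Fin N → EuclideanSpace ℝ (Fin d) → ℝ}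
    {G c : ℝ} (hG : ∀ n w, ‖gradient (f n) w‖ ≤ G) {h : Fin N → ℝ} (hh : ∀ n, |h n| * G ≤ c)
    (ξ w : EuclideanSpace ℝ (Fin d)) (j : Fin d) : |airGradient f h ξ w j - ξ j| ≤ c := by
  have hN' : (0 : ℝ) < N := by exact_mod_cast hN
  have h1 : airGradient f h ξ w j - ξ j = ((1 / (N : ℝ)) • ∑ n, h n • gradient (f n) w) j := by
    simp [airGradient]
  rw [h1, ← Real.norm_eq_abs]
  refine (PiLp.norm_apply_le _ _).trans ?_
  rw [norm_smul, Real.norm_of_nonneg (by positivity)]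
  have h2 : ‖∑ n, h n • gradient (f n) w‖ ≤ N * c := by
    refine (norm_sum_le_of_le _ fun n _ => ?_).trans (by simp : ∑ _n : Fin N, c ≤ N * c)
    rw [norm_smul, Real.norm_eq_abs]
    exact (mul_le_mul_of_nonneg_left (hG n w) (abs_nonneg _)).trans (hh n)
  calc 1 / (N : ℝ) * ‖∑ n, h n • gradient (f n) w‖ ≤ 1 / (N : ℝ) * (N * c) := by gcongr
    _ = c := by field_simp

lemma measureReal_exists_lt_abs_mul_le {Ω : Type*} [MeasurableSpace Ω] {P : Measure Ω}
    [IsProbabilityMeasure P] {N : ℕ} {h : Fin N → Ω → ℝ} (hh : ∀ n, MemLp (h n) 2 P) (G : ℝ)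
    {c : ℝ} (hc : 0 < c) :
    P.real {ω | ∃ n, c < |h n ω| * G} ≤ (∑ n, ∫ ω, h n ω ^ 2 ∂P) * G ^ 2 / c ^ 2 := by
  rw [Set.ofPred_exists]
  refine (measureReal_iUnion_fintype_le _).trans ?_
  rw [Finset.sum_mul, Finset.sum_div]
  refine Finset.sum_le_sum fun n _ => ?_
  rw [le_div_iff₀ (by positivity), mul_comm]
  have hint : Integrable (fun ω => h n ω ^ 2 * G ^ 2) P := (hh n).integrable_sq.mul_const _
  have h1 := mul_meas_ge_le_integral_of_nonneg (μ := P)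
    (ae_of_all _ fun ω => by positivity : 0 ≤ᵐ[P] fun ω => h n ω ^ 2 * G ^ 2) hint (c ^ 2)
  rw [integral_mul_const] at h1
  refine le_trans (mul_le_mul_of_nonneg_left (measureReal_mono fun ω hω => ?_) (sq_nonneg c)) h1
  simp only [Set.mem_ofPred_eq] at hω ⊢
  rw [← sq_abs (h n ω), ← mul_pow]
  gcongr

/-! ### The principle of a single large jump -/

section SingleJump

variable {Ω : Type*} [MeasurableSpace Ω] {P : Measure Ω} {d : ℕ}
  {θ C q F : ℝ} {ξ g : Ω → EuclideanSpace ℝ (Fin d)}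

/-- Two given noise entries are simultaneously large with a probability of squared order. -/
lemma measureReal_two_large_le (hindep : iIndepFun (fun i ω => ξ ω i) P)
    {c : ℝ} (hq : ∀ j, P.real {ω | c < |ξ ω j|} ≤ q) {i j : Fin d} (hij : i ≠ j) :
    P.real {ω | c < |ξ ω i| ∧ c < |ξ ω j|} ≤ q ^ 2 := by
  have hS : MeasurableSet {x : ℝ | c < |x|} := measurableSet_lt measurable_const (by fun_prop)
  have h1 := (hindep.indepFun hij).measure_inter_preimage_eq_mul _ _ hS hS
  have h2 : P.real {ω | c < |ξ ω i| ∧ c < |ξ ω j|} =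
      P.real {ω | c < |ξ ω i|} * P.real {ω | c < |ξ ω j|} := by
    simp only [Measure.real, ← ENNReal.toReal_mul]
    exact congrArg ENNReal.toReal h1
  rw [h2, sq]
  exact mul_le_mul (hq i) (hq j) measureReal_nonneg (measureReal_nonneg.trans (hq i))

/-- The dimension enters only through the negligible terms `F` and `d ^ 2 * q ^ 2`: for `d ≥ 3`
the entry `i` is clipped only if its own noise is large, and for `d = 2` the union bound over all
entries has just two terms. -/
lemma one_sub_measureReal_unclipped_le [IsProbabilityMeasure P] (hd : 2 ≤ d)
    (hθ : θ ∈ Set.Icc (0 : ℝ) 1) (hC : 0 < C) (hindep : iIndepFun (fun i ω => ξ ω i) P)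
    (hq : ∀ j, P.real {ω | C / 8 < |ξ ω j|} ≤ q)
    (hF : P.real {ω | ∃ j, C / 8 < |g ω j - ξ ω j|} ≤ F) (i : Fin d) :
    1 - P.real {ω | Unclipped θ C (g ω) i} ≤ 2 * q + d ^ 2 * q ^ 2 + F := by
  have hq0 : 0 ≤ q := measureReal_nonneg.trans (hq i)
  have hcompl : 1 - P.real {ω | Unclipped θ C (g ω) i} ≤
      P.real {ω | ¬ Unclipped θ C (g ω) i} := by
    have h1 := measureReal_union_le (μ := P) {ω | Unclipped θ C (g ω) i}
      {ω | ¬ Unclipped θ C (g ω) i}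
    have h2 : {ω | Unclipped θ C (g ω) i} ∪ {ω | ¬ Unclipped θ C (g ω) i} = Set.univ := by
      ext ω
      simp [em]
    rw [h2, probReal_univ] at h1
    linarith
  refine hcompl.trans ?_
  have hg : ∀ ω, (¬ ∃ j, C / 8 < |g ω j - ξ ω j|) → ∀ j, |ξ ω j| ≤ C / 8 → |g ω j| ≤ C / 4 := by
    intro ω hω j hj
    have h1 := not_lt.1 (not_exists.1 hω j)
    have h2 := abs_add_le (g ω j - ξ ω j) (ξ ω j)
    rw [sub_add_cancel] at h2
    linarith
  have hun : ∀ ω, |g ω i| ≤ C / 4 → |vecMedian θ (g ω)| ≤ C / 4 → Unclipped θ C (g ω) i := by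
    intro ω h1 h2
    have := abs_sub (g ω i) (vecMedian θ (g ω))
    rw [Unclipped]
    linarith
  rcases hd.eq_or_lt with rfl | hd3
  · have hsub : {ω | ¬ Unclipped θ C (g ω) i} ⊆
        {ω | ∃ j, C / 8 < |g ω j - ξ ω j|} ∪ ⋃ j, {ω | C / 8 < |ξ ω j|} := by
      intro ω hω
      by_contra hcon
      rw [Set.mem_union, not_or] at hcon
      have hsmall : ∀ j, |g ω j| ≤ C / 4 := fun j =>
        hg ω hcon.1 j (not_lt.1 fun h => hcon.2 (Set.mem_iUnion.2 ⟨j, h⟩))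
      exact hω (hun ω (hsmall i) (abs_vecMedian_le_of_forall (by norm_num) hθ hsmall))
    have h1 := measureReal_mono (μ := P) hsub
    have h2 := h1.trans (measureReal_union_le _ _)
    have h3 := (measureReal_iUnion_fintype_le (μ := P) fun j => {ω | C / 8 < |ξ ω j|}).trans
      (Finset.sum_le_sum fun j _ => hq j)
    simp only [Finset.sum_const, Finset.card_univ, Fintype.card_fin, nsmul_eq_mul] at h3
    push_cast at h3 ⊢
    nlinarith [sq_nonneg q]
  · have hsub : {ω | ¬ Unclipped θ C (g ω) i} ⊆
        {ω | ∃ j, C / 8 < |g ω j - ξ ω j|} ∪ ({ω | C / 8 < |ξ ω i|} ∪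
          ⋃ p : Fin d × Fin d, {ω | p.1 ≠ p.2 ∧ C / 8 < |ξ ω p.1| ∧ C / 8 < |ξ ω p.2|}) := by
      intro ω hω
      by_contra hcon
      rw [Set.mem_union, Set.mem_union, not_or, not_or] at hcon
      obtain ⟨h1, h2, h3⟩ := hcon
      refine hω (hun ω (hg ω h1 i (not_lt.1 h2)) ?_)
      by_cases hbig : ∃ j₀, C / 8 < |ξ ω j₀|
      · obtain ⟨j₀, hj₀⟩ := hbig
        exact abs_vecMedian_le_of_forall_ne (i := j₀) hd3 hθ fun j hj => hg ω h1 j <|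
          not_lt.1 fun h => h3 (Set.mem_iUnion.2 ⟨(j, j₀), hj, h, hj₀⟩)
      · exact abs_vecMedian_le_of_forall (by omega) hθ fun j =>
          hg ω h1 j (not_lt.1 (not_exists.1 hbig j))
    have h1 := (measureReal_mono (μ := P) hsub).trans (measureReal_union_le _ _)
    have h2 := measureReal_union_le (μ := P) {ω | C / 8 < |ξ ω i|}
      (⋃ p : Fin d × Fin d, {ω | p.1 ≠ p.2 ∧ C / 8 < |ξ ω p.1| ∧ C / 8 < |ξ ω p.2|})
    have h3 : P.real (⋃ p : Fin d × Fin d,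
        {ω | p.1 ≠ p.2 ∧ C / 8 < |ξ ω p.1| ∧ C / 8 < |ξ ω p.2|}) ≤
        ∑ _p : Fin d × Fin d, q ^ 2 := by
      refine (measureReal_iUnion_fintype_le _).trans (Finset.sum_le_sum fun p _ => ?_)
      by_cases hp : p.1 = p.2
      · simp [hp, sq_nonneg]
      · exact (measureReal_mono fun ω hω => hω.2).trans
          (measureReal_two_large_le hindep hq hp)
    simp only [Finset.sum_const, Finset.card_univ, Fintype.card_prod, Fintype.card_fin,
      nsmul_eq_mul] at h3
    push_cast at h3
    nlinarith [hq i]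

/-- The jump is taken in the direction in which `θ` puts at most half of the weight of the
median. -/
lemma le_one_sub_measureReal_unclipped [IsProbabilityMeasure P] (hd : 2 ≤ d)
    (hθ : θ ∈ Set.Icc (0 : ℝ) 1) (hC : 0 < C) (hξ : Measurable ξ)
    (hindep : iIndepFun (fun i ω => ξ ω i) P)
    (hq : ∀ j, P.real {ω | C / 8 < |ξ ω j|} ≤ q)
    (hF : P.real {ω | ∃ j, C / 8 < |g ω j - ξ ω j|} ≤ F) (i : Fin d) {p : ℝ}
    (hp : p ≤ P.real {ω | 4 * C < ξ ω i}) (hp' : p ≤ P.real {ω | ξ ω i < -(4 * C)}) :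
    p - d ^ 2 * q ^ 2 - F ≤ 1 - P.real {ω | Unclipped θ C (g ω) i} := by
  have hξi : Measurable fun ω => ξ ω i := by fun_prop
  obtain ⟨E, hE, hpE, hEbig, hEclip⟩ : ∃ E : Set Ω, MeasurableSet E ∧ p ≤ P.real E ∧
      (∀ ω ∈ E, C / 8 < |ξ ω i|) ∧ ∀ ω ∈ E, (∀ j, |g ω j - ξ ω j| ≤ C / 8) →
        (∀ j, j ≠ i → |ξ ω j| ≤ C / 8) → ¬ Unclipped θ C (g ω) i := by
    rcases le_total θ (1 / 2) with h | h
    · refine ⟨_, measurableSet_lt measurable_const hξi, hp, fun ω hω => ?_, fun ω hω h1 h2 => ?_⟩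
      · simp only [Set.mem_ofPred_eq] at hω
        exact lt_of_lt_of_le (by linarith) (le_abs_self _)
      · simp only [Set.mem_ofPred_eq] at hω
        have h3 := lt_sub_vecMedian (v := g ω) (i := i) hd h hθ.1 hC
          (by linarith [(abs_le.1 (h1 i)).1])
          fun j hj => by linarith [(abs_le.1 (h1 j)).2, (abs_le.1 (h2 j hj)).2]
        exact not_le.2 (h3.trans_le (le_abs_self _))
    · refine ⟨_, measurableSet_lt hξi measurable_const, hp', fun ω hω => ?_, fun ω hω h1 h2 => ?_⟩
      · simp only [Set.mem_ofPred_eq] at hω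
        exact lt_of_lt_of_le (by linarith) (neg_le_abs _)
      · simp only [Set.mem_ofPred_eq] at hω
        have h3 := sub_vecMedian_lt_neg (v := g ω) (i := i) hd h hθ.2 hC
          (by linarith [(abs_le.1 (h1 i)).2])
          fun j hj => by linarith [(abs_le.1 (h1 j)).1, (abs_le.1 (h2 j hj)).1]
        exact not_le.2 (lt_of_lt_of_le (by linarith) (neg_le_abs _))
  have hsub : {ω | Unclipped θ C (g ω) i} ⊆ Eᶜ ∪ ({ω | ∃ j, C / 8 < |g ω j - ξ ω j|} ∪
      ⋃ j, {ω | i ≠ j ∧ C / 8 < |ξ ω i| ∧ C / 8 < |ξ ω j|}) := by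
    intro ω hω
    by_contra hcon
    rw [Set.mem_union, Set.mem_union, not_or, not_or, Set.notMem_compl_iff] at hcon
    obtain ⟨h1, h2, h3⟩ := hcon
    exact hEclip ω h1 (fun j => not_lt.1 (not_exists.1 h2 j))
      (fun j hj => not_lt.1 fun h => h3 (Set.mem_iUnion.2 ⟨j, hj.symm, hEbig ω h1, h⟩)) hω
  have h1 := (measureReal_mono (μ := P) hsub).trans (measureReal_union_le _ _)
  have h2 := measureReal_union_le (μ := P) {ω | ∃ j, C / 8 < |g ω j - ξ ω j|}
    (⋃ j, {ω | i ≠ j ∧ C / 8 < |ξ ω i| ∧ C / 8 < |ξ ω j|})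
  have h3 : P.real (⋃ j, {ω | i ≠ j ∧ C / 8 < |ξ ω i| ∧ C / 8 < |ξ ω j|}) ≤
      ∑ _j : Fin d, q ^ 2 := by
    refine (measureReal_iUnion_fintype_le _).trans (Finset.sum_le_sum fun j _ => ?_)
    by_cases hj : i = j
    · simp [hj, sq_nonneg]
    · exact (measureReal_mono fun ω hω => hω.2).trans
        (measureReal_two_large_le hindep hq hj)
  simp only [Finset.sum_const, Finset.card_univ, Fintype.card_fin, nsmul_eq_mul] at h3
  rw [probReal_compl_eq_one_sub hE] at h1
  have hd1 : (d : ℝ) * q ^ 2 ≤ d ^ 2 * q ^ 2 := by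
    have : (1 : ℝ) ≤ d := by exact_mod_cast (by omega : 1 ≤ d)
    gcongr
    nlinarith
  linarith

end SingleJump

/-! ### The clipping probability -/

theorem lemma1 (α : ℝ) (hα₀ : 0 < α) (hα₂ : α < 2) :
    ∃ a b : ℝ, 0 < a ∧ a ≤ b ∧
      ∀ {Ω : Type*} [MeasurableSpace Ω] (P : Measure Ω) [IsProbabilityMeasure P]
        (d N : ℕ) (_hd : 2 ≤ d) (_hN : 1 ≤ N)
        (τ : ℝ) (_hτ : 0 < τ) (θ : ℝ) (_hθ : θ ∈ Set.Icc (0 : ℝ) 1) (η : ℝ)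
        (w₀ : EuclideanSpace ℝ (Fin d))
        -- local losses with bounded gradients
        (f : Fin N → EuclideanSpace ℝ (Fin d) → ℝ) (_hf : ∀ n, Differentiable ℝ (f n))
        (G : ℝ) (_hG : ∀ n w, ‖gradient (f n) w‖ ≤ G)
        -- channel fading: unit mean, finite variance, independent over clients, i.i.d. over time
        (h : ℕ → Fin N → Ω → ℝ) (_hh : ∀ k n, MemLp (h k n) 2 P)
        (_hh_meas : ∀ k n, Measurable (h k n))
        (_hh_mean : ∀ k n, ∫ ω, h k n ω ∂P = 1)
        (_hh_indep : iIndepFun (fun q : ℕ × Fin N => h q.1 q.2) P)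
        (_hh_ident : ∀ k n, IdentDistrib (h k n) (h 0 n) P P)
        -- noise: in every round the entries are independent and symmetric stable
        (ξ : ℕ → Ω → EuclideanSpace ℝ (Fin d)) (_hξ_meas : ∀ k, Measurable (ξ k))
        (_hξ_indep : ∀ k, iIndepFun (fun (i : Fin d) (ω : Ω) => ξ k ω i) P)
        (_hξ_law : ∀ k i, IsSymmStable α τ (P.map fun ω => ξ k ω i)),
        (∀ (k : ℕ) (i : Fin d),
          unclippedProb P θ η f h ξ w₀ k i ~[atTop] fun C : ℝ => 1 - τ ^ α / C ^ α) ∧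
        ∀ᶠ C : ℝ in atTop, ∀ (k : ℕ) (i : Fin d),
          a * (τ ^ α / C ^ α) ≤ 1 - unclippedProb P θ η f h ξ w₀ k i C ∧
          1 - unclippedProb P θ η f h ξ w₀ k i C ≤ b * (τ ^ α / C ^ α) := by
  obtain ⟨κ, hκ, hlow⟩ := exists_le_measureReal_abs_gt hα₀ hα₂
  -- `K * u` and `4 * a * u`, with `u = τ ^ α / C ^ α`, bound the tail at `C / 8` from above and
  -- the one-sided tail at `4 * C` from below; each negligible term is eventually at most `a * u`.
  set K : ℝ := 2 * 2 ^ α * 8 ^ α with hK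
  set a : ℝ := κ / 8 / 4 ^ α with ha
  have hK0 : 0 < K := by positivity
  have ha0 : 0 < a := by positivity
  refine ⟨a, 2 * a + 2 * K, ha0, by linarith, ?_⟩
  intro Ω _ P _ d N hd hN τ hτ θ hθ η w₀ f _ G hG h hh _ _ _ hident ξ hξ hindep hlaw
  have hu : Tendsto (fun C : ℝ => τ ^ α / C ^ α) atTop (nhds 0) :=
    tendsto_const_nhds.div_atTop (tendsto_rpow_atTop hα₀)
  set V : ℝ := (∑ n, ∫ ω, h 0 n ω ^ 2 ∂P) * G ^ 2 with hV
  have hbounds : ∀ᶠ C : ℝ in atTop, ∀ (k : ℕ) (i : Fin d),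
      a * (τ ^ α / C ^ α) ≤ 1 - unclippedProb P θ η f h ξ w₀ k i C ∧
      1 - unclippedProb P θ η f h ξ w₀ k i C ≤ (2 * a + 2 * K) * (τ ^ α / C ^ α) := by
    have hev1 : ∀ᶠ C : ℝ in atTop, d ^ 2 * K ^ 2 * (τ ^ α / C ^ α) < a := by
      have := hu.const_mul ((d : ℝ) ^ 2 * K ^ 2)
      rw [mul_zero] at this
      exact this.eventually_lt_const ha0
    -- Since `α < 2`, the fading term of order `C ^ (-2)` is negligible.
    have hev2 : ∀ᶠ C : ℝ in atTop, V * 64 / C ^ (2 - α) < a * τ ^ α :=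
      (tendsto_const_nhds.div_atTop (tendsto_rpow_atTop (by linarith))).eventually_lt_const
        (by positivity)
    filter_upwards [hev1, hev2, eventually_gt_atTop 0, eventually_ge_atTop (Real.pi * τ)]
      with C h1 h2 hC hCτ k i
    set u : ℝ := τ ^ α / C ^ α with hu_def
    have hu0 : 0 < u := by positivity
    have hmeas : ∀ j, Measurable fun ω => ξ k ω j := fun j => by
      have := hξ k
      fun_prop
    have hprob : ∀ j, IsProbabilityMeasure (P.map fun ω => ξ k ω j) := fun j =>
      Measure.isProbabilityMeasure_map (hmeas j).aemeasurable
    have hq : ∀ j, P.real {ω | C / 8 < |ξ k ω j|} ≤ K * u := by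
      intro j
      have h3 := (hlaw k j).measureReal_abs_gt_le hα₀ hτ (x := C / 8) (by positivity)
      rw [map_measureReal_apply (hmeas j) (measurableSet_lt measurable_const (by fun_prop))] at h3
      refine h3.trans_eq ?_
      rw [show τ / (C / 8) = 8 * (τ / C) by field_simp, Real.mul_rpow (by norm_num) (by positivity),
        Real.div_rpow hτ.le hC.le, hK, hu_def]
      ring
    have htail : 4 * (a * u) ≤ (P.map fun ω => ξ k ω i).real (Set.Ioi (4 * C)) := by
      have h3 := hlow τ _ hτ (hlaw k i) (4 * C) (by linarith)
      rw [← (hlaw k i).two_mul_measureReal_Ioi (by positivity)] at h3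
      rw [show τ / (4 * C) = τ / C / 4 by field_simp, Real.div_rpow (by positivity) (by norm_num),
        Real.div_rpow hτ.le hC.le, ← hu_def] at h3
      have h4 : 4 * (a * u) = κ * (u / 4 ^ α) / 2 := by rw [ha]; ring
      linarith
    have hp : 4 * (a * u) ≤ P.real {ω | 4 * C < ξ k ω i} := by
      rwa [map_measureReal_apply (hmeas i) measurableSet_Ioi] at htail
    have hp' : 4 * (a * u) ≤ P.real {ω | ξ k ω i < -(4 * C)} := by
      rwa [← (hlaw k i).measureReal_Iio_neg,
        map_measureReal_apply (hmeas i) measurableSet_Iio] at htail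
    set g : Ω → EuclideanSpace ℝ (Fin d) := fun ω =>
      macGradient θ C η f (fun l n => h l n ω) (fun l => ξ l ω) w₀ k with hg
    have hF : P.real {ω | ∃ j, C / 8 < |g ω j - ξ k ω j|} ≤ a * u := by
      have hsub : {ω | ∃ j, C / 8 < |g ω j - ξ k ω j|} ⊆ {ω | ∃ n, C / 8 < |h k n ω| * G} := by
        rintro ω ⟨j, hj⟩
        by_contra hcon
        exact not_le.2 hj (abs_airGradient_sub_le hN hG
          (fun n => not_lt.1 (not_exists.1 hcon n)) _ _ j)
      have hsq : ∀ n, ∫ ω, h k n ω ^ 2 ∂P = ∫ ω, h 0 n ω ^ 2 ∂P := fun n =>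
        ((hident k n).comp (measurable_id.pow_const 2)).integral_eq
      have h3 := (measureReal_mono hsub).trans
        (measureReal_exists_lt_abs_mul_le (hh k) G (c := C / 8) (by positivity))
      simp only [hsq] at h3
      rw [← hV] at h3
      refine h3.trans ?_
      have hsplit : C ^ 2 = C ^ (2 - α) * C ^ α := by
        rw [← Real.rpow_add hC, ← Real.rpow_natCast]
        norm_num
      have h4 : V / (C / 8) ^ 2 = V * 64 / C ^ (2 - α) / C ^ α := by
        rw [div_div, ← hsplit]
        field_simp
        norm_num
      rw [h4, hu_def, ← mul_div_assoc]
      gcongr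
    have hsmall : d ^ 2 * (K * u) ^ 2 ≤ a * u := by
      calc d ^ 2 * (K * u) ^ 2 = d ^ 2 * K ^ 2 * u * u := by ring
        _ ≤ a * u := by gcongr
    have hlower := le_one_sub_measureReal_unclipped hd hθ hC (hξ k) (hindep k) hq hF i hp hp'
    have hupper := one_sub_measureReal_unclipped_le hd hθ hC (hindep k) hq hF i
    have : unclippedProb P θ η f h ξ w₀ k i C = P.real {ω | Unclipped θ C (g ω) i} := rfl
    rw [this]
    constructor <;> linarith [mul_pos ha0 hu0]
  refine ⟨fun k i => ?_, hbounds⟩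
  -- Both sides tend to `1`.
  have hv : Tendsto (fun C : ℝ => 1 - τ ^ α / C ^ α) atTop (nhds 1) := by
    simpa using hu.const_sub 1
  have hw : Tendsto (unclippedProb P θ η f h ξ w₀ k i) atTop (nhds 1) := by
    have hb : Tendsto (fun C : ℝ => 1 - (2 * a + 2 * K) * (τ ^ α / C ^ α)) atTop (nhds 1) := by
      simpa using (hu.const_mul (2 * a + 2 * K)).const_sub 1
    refine tendsto_of_tendsto_of_tendsto_of_le_of_le' hb tendsto_const_nhds ?_
      (Eventually.of_forall fun C => measureReal_le_one)
    filter_upwards [hbounds] with C hC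
    linarith [(hC k i).2]
  exact ((isEquivalent_const_iff_tendsto one_ne_zero).2 hw).trans
    ((isEquivalent_const_iff_tendsto one_ne_zero).2 hv).symm
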